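/- Let $A$ be a simplicial line arrangement in the real projective plane, i.e. a finite set of lines such that every connected component of the complement of their union (every cell of $A$) is an open triangle. Embed the affine plane in $\mathbb R^3$ as the plane $z=1$, so that the projective plane is the set of lines through the origin of $\mathbb R^3$ and the line at infinity corresponds to the plane $z=0$. Let $\hat A$ be the arrangement consisting of, for each line $\ell\in A$ other than the line at infinity, the plane through the origin and $\ell$, together with the plane $z=0$ if $A$ contains the line at infinity. Let $C_A$ be the graph that has one vertex for each cell of $\hat A$ (connected component of the complement in $\mathbb R^3$ of the union of the planes of $\hat A$), two distinct cells being adjacent when they meet along a two-dimensional face of $\hat A$. Then $C_A$ is a finite cubic (3-regular) partial cube, that is, it is connected and its vertices can be labelled by binary vectors of some fixed finite length so that the graph distance of any two vertices equals the Hamming distance of their labels. The number of vertices of $C_A$ is exactly twice the (finite) number of triangles (triangular cells) of $A$. -/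

import Mathlib

open scoped LinearAlgebra.Projectivization

noncomputable section

/-! ### Partial cubes and cubic graphs -/

/-- A (finite) partial cube: a connected graph whose vertices can be labelled by binary vectors
of a common length so that graph distance equals the Hamming distance of the labels. -/
def SimpleGraph.IsPartialCube {V : Type*} (G : SimpleGraph V) : Prop :=
  G.Connected ∧ ∃ (n : ℕ) (label : V → (Fin n → Bool)),
    ∀ v w : V, G.dist v w = hammingDist (label v) (label w)

/-- A cubic graph: every vertex has exactly three neighbours. -/
def SimpleGraph.IsCubic {V : Type*} (G : SimpleGraph V) : Prop :=
  ∀ v : V, (G.neighborSet v).ncard = 3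

/-! ### Hyperplane arrangements in a real vector space and their cell-adjacency graphs -/

namespace HyperplaneArrangement

variable {E : Type*} [NormedAddCommGroup E] [NormedSpace ℝ E]

/-- The points that lie on no hyperplane of the arrangement. -/
def complement (A : Set (AffineSubspace ℝ E)) : Set E :=
  {x | ∀ H ∈ A, x ∉ H}

/-- The (full-dimensional, open) cells: the connected components of the complement. -/
def cells (A : Set (AffineSubspace ℝ E)) : Set (Set E) :=
  {c | ∃ x ∈ complement A, c = connectedComponentIn (complement A) x}

/-- The (relatively open) face of the arrangement through `x`: all points having the same
position as `x` (on it, or strictly on a given side of it) with respect to each hyperplane. -/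
def faceThrough (A : Set (AffineSubspace ℝ E)) (x : E) : Set E :=
  {y | ∀ H ∈ A, (x ∈ H ∧ y ∈ H) ∨ H.SSameSide x y}

/-- `F` is a facet of the arrangement, i.e. a face of codimension one. -/
def IsFacet (A : Set (AffineSubspace ℝ E)) (F : Set E) : Prop :=
  (∃ x, F = faceThrough A x) ∧
    Module.finrank ℝ (vectorSpan ℝ F) + 1 = Module.finrank ℝ E

/-- The cell-adjacency graph: one vertex for each cell, two distinct cells being adjacent when
they meet along a face of codimension one. -/
def cellGraph (A : Set (AffineSubspace ℝ E)) : SimpleGraph (cells A) where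
  Adj c c' := c ≠ c' ∧
    ∃ F, IsFacet A F ∧ F ⊆ closure (c : Set E) ∩ closure (c' : Set E)
  symm := ⟨fun c c' h => by
    obtain ⟨hne, F, hF, hs⟩ := h
    exact ⟨hne.symm, F, hF, fun x hx => ⟨(hs hx).2, (hs hx).1⟩⟩⟩
  loopless := ⟨fun c h => h.1 rfl⟩

end HyperplaneArrangement

/-! ### Line arrangements in the real projective plane -/

/-- Three-dimensional real space. -/
abbrev R3 : Type := Fin 3 → ℝ

/-- The real projective plane carries the quotient topology from the nonzero vectors. -/
instance projectivePlaneTopology : TopologicalSpace (ℙ ℝ R3) :=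
  TopologicalSpace.coinduced (Projectivization.mk' ℝ) inferInstance

/-- Lines of the real projective plane, in Mathlib's projective subspaces. -/
abbrev ProjLine : Type :=
  {L : Projectivization.Subspace ℝ R3 // Module.finrank ℝ L.submodule = 2}

namespace LineArrangement

/-- The points of the projective plane on no line of the arrangement. -/
def complement (A : Finset ProjLine) : Set (ℙ ℝ R3) :=
  {p | ∀ L ∈ A, p ∉ L.1}

/-- The cells of the arrangement: the connected components of the complement of its lines. -/
def cells (A : Finset ProjLine) : Set (Set (ℙ ℝ R3)) :=
  {c | ∃ p ∈ complement A, c = connectedComponentIn (complement A) p}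

/-- An open triangle of the projective plane: its vertices are three non-collinear points
`[b 0], [b 1], [b 2]`, and it consists of the points that are positive combinations of
the representatives `b i`. (The four triangles with the same vertices arise from the sign choices
of the representatives.) -/
def IsTriangle (c : Set (ℙ ℝ R3)) : Prop :=
  ∃ b : Fin 3 → R3, LinearIndependent ℝ b ∧
    c = {p | ∃ (t : Fin 3 → ℝ) (hv : ∑ i, t i • b i ≠ 0),
      (∀ i, 0 < t i) ∧ p = Projectivization.mk ℝ (∑ i, t i • b i) hv}

/-- The triangles of the arrangement: its triangular cells. -/
def triangles (A : Finset ProjLine) : Set (Set (ℙ ℝ R3)) :=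
  {c | c ∈ cells A ∧ IsTriangle c}

/-- An arrangement is simplicial if each of its cells is a triangle. -/
def IsSimplicial (A : Finset ProjLine) : Prop :=
  ∀ c ∈ cells A, IsTriangle c

/-- The plane `z = 0` through the origin. -/
def horizontalPlane : Submodule ℝ R3 :=
  LinearMap.ker (LinearMap.proj (2 : Fin 3) : R3 →ₗ[ℝ] ℝ)

/-- The line at infinity, when the affine plane is embedded as `z = 1`. -/
def lineAtInfinity : Projectivization.Subspace ℝ R3 :=
  Projectivization.Subspace.submodule.symm horizontalPlane

/-- The part of a projective line that is visible in the plane `z = 1` (empty for the line at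
infinity, an affine line for the others). -/
def affineTrace (L : ProjLine) : Set R3 :=
  {v | v 2 = 1 ∧ ∃ hv : v ≠ 0, Projectivization.mk ℝ v hv ∈ L.1}

/-- The central plane arrangement lifting `A`: for each line of `A` in the plane `z = 1` the plane
through this line and the origin, together with the plane `z = 0` if `A` contains the line at
infinity. -/
def lift (A : Finset ProjLine) : Set (AffineSubspace ℝ R3) :=
  {H | ∃ L ∈ A, L.1 ≠ lineAtInfinity ∧ H = affineSpan ℝ (insert 0 (affineTrace L))} ∪
  {H | (∃ L ∈ A, L.1 = lineAtInfinity) ∧ H = horizontalPlane.toAffineSubspace}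

/-- The graph `C_A`: the cell-adjacency graph of the lifted arrangement. -/
def graph (A : Finset ProjLine) : SimpleGraph (HyperplaneArrangement.cells (lift A)) :=
  HyperplaneArrangement.cellGraph (lift A)

end LineArrangement

end

/-! Choose for each line of `A` a linear functional vanishing on its plane. The planes cut space
into open convex cones, each determined by the signs of the functionals, so sign vectors label the
cells injectively. Two cells are adjacent exactly when their labels differ in one place
(`cellGraph_adj_iff`), so graph distance is at least Hamming distance.

Simpliciality enters through `exists_wall`. A triangular cell lifts to the cone of vectors with
positive coordinates in some basis of three vectors. Each coordinate is a nonzero multiple of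
exactly one functional, and crossing that wall flips this sign only. The three walls give exactly
three neighbours. If a point of another cell lies outside the cone, one of its coordinates is not
positive, so the corresponding wall separates the two cells and crossing it brings the labels
closer. Repeating this yields a path as short as the Hamming distance
(`SimpleGraph.dist_eq_hammingDist`).

For the count, passing to projective classes is two-to-one on cells: a cone and its negative have
the same image, and the sign of any one functional tells them apart (`cellsEquiv`). This needs a
line in `A`, which exists because the whole projective plane is not a triangle. -/

open Filter Topology in
/-- A sign condition on a functional is stable under small perturbations. -/
theorem eventually_pos_mul_apply {E : Type*} [NormedAddCommGroup E] [NormedSpace ℝ E]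
    {g : E →L[ℝ] ℝ} {a : ℝ} {p : E} (v : E) (h : 0 < a * g p) :
    ∀ᶠ t in 𝓝[>] (0 : ℝ), 0 < a * g (p + t • v) := by
  have hc : Continuous fun t : ℝ => a * g (p + t • v) := by fun_prop
  have h0 : 0 < (fun t : ℝ => a * g (p + t • v)) 0 := by simpa using h
  exact (hc.continuousAt.eventually (lt_mem_nhds h0)).filter_mono nhdsWithin_le_nhds

/-! ### Isometric binary labellings of graphs -/

/-- A graph whose vertices carry binary labels, adjacent ones at Hamming distance at most one, such
that one can always step closer to a given other vertex, is isometrically labelled. -/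
theorem SimpleGraph.dist_eq_hammingDist {V ι : Type*} [Fintype ι] [Nonempty V] {G : SimpleGraph V}
    (label : V → ι → Bool)
    (hadj : ∀ v w, G.Adj v w → hammingDist (label v) (label w) ≤ 1)
    (hstep : ∀ v w, v ≠ w → ∃ u, G.Adj v u ∧
      hammingDist (label u) (label w) < hammingDist (label v) (label w)) :
    G.Connected ∧ ∀ v w, G.dist v w = hammingDist (label v) (label w) := by
  have hwalk : ∀ n v w, hammingDist (label v) (label w) ≤ n →
      ∃ p : G.Walk v w, p.length ≤ n := by
    intro n
    induction n with
    | zero =>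
      intro v w h
      by_cases hvw : v = w
      · subst hvw
        exact ⟨.nil, by simp⟩
      · obtain ⟨u, -, hu⟩ := hstep v w hvw
        omega
    | succ n ih =>
      intro v w h
      by_cases hvw : v = w
      · subst hvw
        exact ⟨.nil, by simp⟩
      · obtain ⟨u, hvu, hu⟩ := hstep v w hvw
        obtain ⟨p, hp⟩ := ih u w (by omega)
        exact ⟨.cons hvu p, by simpa using hp⟩
  have hlow : ∀ v w (p : G.Walk v w), hammingDist (label v) (label w) ≤ p.length := by
    intro v w p
    induction p with
    | nil => simp
    | cons h p ih =>
      rw [SimpleGraph.Walk.length_cons]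
      have := hammingDist_triangle (label _) (label _) (label _) |>.trans
        (add_le_add (hadj _ _ h) ih)
      omega
  have hconn : G.Connected :=
    { preconnected := fun v w => ⟨(hwalk _ v w le_rfl).choose⟩
      nonempty := inferInstance }
  refine ⟨hconn, fun v w => le_antisymm ?_ ?_⟩
  · obtain ⟨p, hp⟩ := hwalk _ v w le_rfl
    exact (SimpleGraph.dist_le p).trans hp
  · obtain ⟨p, hp⟩ := (hconn.preconnected v w).exists_walk_length_eq_dist
    exact hp ▸ hlow v w p

theorem hammingDist_comp_equiv {ι κ β : Type*} [Fintype ι] [Fintype κ] [DecidableEq β]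
    (e : κ ≃ ι) (x y : ι → β) :
    hammingDist (fun k => x (e k)) (fun k => y (e k)) = hammingDist x y := by
  unfold hammingDist
  exact Finset.card_equiv e (by simp)

/-! ### Cells of a central arrangement as sign cones -/

namespace HyperplaneArrangement

variable {E : Type*} [NormedAddCommGroup E] [NormedSpace ℝ E] {ι : Type*}

/-- The arrangement of the kernels of a family of functionals. -/
def centralArrangement (f : ι → E →L[ℝ] ℝ) : Set (AffineSubspace ℝ E) :=
  Set.range fun i => (LinearMap.ker (f i : E →ₗ[ℝ] ℝ)).toAffineSubspace

/-- The points strictly on the same side as `x` of the kernel of each functional. -/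
def signCone (f : ι → E →L[ℝ] ℝ) (x : E) : Set E := {y | ∀ i, 0 < f i x * f i y}

/-- The vector of the signs at `x` of a family of functionals. -/
noncomputable def signVector (f : ι → E →L[ℝ] ℝ) (x : E) (i : ι) : Bool := decide (0 < f i x)

variable {f : ι → E →L[ℝ] ℝ} {x y z : E}

theorem mem_complement_centralArrangement :
    x ∈ complement (centralArrangement f) ↔ ∀ i, f i x ≠ 0 := by
  simp [complement, centralArrangement]

theorem self_mem_signCone (hx : ∀ i, f i x ≠ 0) : x ∈ signCone f x :=
  fun i => mul_self_pos.2 (hx i)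

theorem ne_zero_of_mem_signCone (h : y ∈ signCone f x) (i : ι) : f i y ≠ 0 := by
  intro h0
  simpa [h0] using h i

theorem signVector_eq_iff (hx : ∀ i, f i x ≠ 0) (hy : ∀ i, f i y ≠ 0) {i : ι} :
    signVector f x i = signVector f y i ↔ 0 < f i x * f i y := by
  have hxi := hx i
  have hyi := hy i
  simp only [signVector, decide_eq_decide, mul_pos_iff]
  rcases lt_or_gt_of_ne hxi with h | h <;> rcases lt_or_gt_of_ne hyi with h' | h' <;>
    simp [h, h', h.le, h'.le, not_lt_of_ge]

theorem signVector_ne_iff (hx : ∀ i, f i x ≠ 0) (hy : ∀ i, f i y ≠ 0) {i : ι} :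
    signVector f x i ≠ signVector f y i ↔ f i x * f i y < 0 := by
  rw [Ne, signVector_eq_iff hx hy, not_lt]
  exact ⟨fun h => lt_of_le_of_ne h (mul_ne_zero (hx i) (hy i)), le_of_lt⟩

theorem mem_signCone_iff_signVector (hx : ∀ i, f i x ≠ 0) (hy : ∀ i, f i y ≠ 0) :
    y ∈ signCone f x ↔ signVector f x = signVector f y := by
  rw [funext_iff]
  exact forall_congr' fun i => (signVector_eq_iff hx hy).symm

theorem signCone_eq_of_mem (h : y ∈ signCone f x) : signCone f x = signCone f y := by
  have key : ∀ a b c : ℝ, 0 < a * b → (0 < a * c ↔ 0 < b * c) := by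
    intro a b c h
    rcases mul_pos_iff.1 h with ⟨ha, hb⟩ | ⟨ha, hb⟩
    · simp [mul_pos_iff_of_pos_left, ha, hb]
    · simp [mul_pos_iff, ha, hb, ha.le, hb.le, not_lt_of_ge]
  ext w
  exact forall_congr' fun i => key _ _ _ (h i)

theorem signCone_eq_iff (hx : ∀ i, f i x ≠ 0) (hy : ∀ i, f i y ≠ 0) :
    signCone f x = signCone f y ↔ signVector f x = signVector f y := by
  rw [← mem_signCone_iff_signVector hx hy]
  exact ⟨fun h => h ▸ self_mem_signCone hy, signCone_eq_of_mem⟩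

theorem convex_signCone : Convex ℝ (signCone f x) := by
  intro u hu v hv a b ha hb hab i
  have hu := hu i
  have hv := hv i
  rw [map_add, map_smul, map_smul, smul_eq_mul, smul_eq_mul]
  rcases ha.eq_or_lt with rfl | ha
  · simpa [show b = 1 by linarith] using hv
  · have := mul_pos ha hu
    have := mul_nonneg hb hv.le
    linarith

theorem isOpen_signCone [Finite ι] : IsOpen (signCone f x) := by
  have : signCone f x = ⋂ i, {y | 0 < f i x * f i y} := by
    ext; simp [signCone]
  rw [this]
  exact isOpen_iInter_of_finite fun i => isOpen_lt continuous_const (by fun_prop)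

theorem neg_mem_signCone_iff : -y ∈ signCone f x ↔ y ∈ signCone f (-x) := by
  simp [signCone]

theorem smul_mem_signCone_iff {a : ℝ} (ha : 0 < a) : a • y ∈ signCone f x ↔ y ∈ signCone f x := by
  refine forall_congr' fun i => ?_
  rw [map_smul, smul_eq_mul, mul_left_comm, mul_pos_iff_of_pos_left ha]

/-- The cells of a central arrangement are its sign cones. -/
theorem connectedComponentIn_complement (hx : ∀ i, f i x ≠ 0) :
    connectedComponentIn (complement (centralArrangement f)) x = signCone f x := by
  have hx' := mem_complement_centralArrangement.2 hx
  apply Set.Subset.antisymm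
  · intro y hy i
    by_contra hneg
    have hpre : IsPreconnected (connectedComponentIn (complement (centralArrangement f)) x) :=
      isPreconnected_connectedComponentIn
    have hsub := connectedComponentIn_subset (complement (centralArrangement f)) x
    have hxm := mem_connectedComponentIn hx'
    have hc : ContinuousOn (fun w => f i x * f i w)
      (connectedComponentIn (complement (centralArrangement f)) x) := by fun_prop
    -- A change of sign inside a connected subset of the complement would force a zero of `f i`
    -- there.
    obtain ⟨w, hw, hw0⟩ := hpre.intermediate_value hy hxm hc
      ⟨not_lt.1 hneg, mul_self_nonneg (f i x)⟩
    exact mul_ne_zero (hx i) (mem_complement_centralArrangement.1 (hsub hw) i) hw0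
  · exact convex_signCone.isPreconnected.subset_connectedComponentIn (self_mem_signCone hx)
      fun y hy => mem_complement_centralArrangement.2 (ne_zero_of_mem_signCone hy)

theorem mem_cells_iff {c : Set E} :
    c ∈ cells (centralArrangement f) ↔ ∃ x, (∀ i, f i x ≠ 0) ∧ c = signCone f x := by
  constructor
  · rintro ⟨x, hx, rfl⟩
    rw [mem_complement_centralArrangement] at hx
    exact ⟨x, hx, connectedComponentIn_complement hx⟩
  · rintro ⟨x, hx, rfl⟩
    exact ⟨x, mem_complement_centralArrangement.2 hx, (connectedComponentIn_complement hx).symm⟩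

/-- The cell of a point on no hyperplane of the arrangement. -/
def cellOf (f : ι → E →L[ℝ] ℝ) (x : E) (hx : ∀ i, f i x ≠ 0) : cells (centralArrangement f) :=
  ⟨signCone f x, mem_cells_iff.2 ⟨x, hx, rfl⟩⟩

theorem exists_cellOf_eq (c : cells (centralArrangement f)) :
    ∃ x hx, c = cellOf f x hx := by
  obtain ⟨x, hx, h⟩ := mem_cells_iff.1 c.2
  exact ⟨x, hx, Subtype.ext h⟩

/-- The label of a cell: the sign vector of its points. -/
noncomputable def cellLabel (c : cells (centralArrangement f)) : ι → Bool :=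
  signVector f (exists_cellOf_eq c).choose

theorem cellLabel_cellOf (hx : ∀ i, f i x ≠ 0) : cellLabel (cellOf f x hx) = signVector f x := by
  obtain ⟨hy, h⟩ := (exists_cellOf_eq (cellOf f x hx)).choose_spec
  exact ((signCone_eq_iff hx hy).1 (congrArg Subtype.val h)).symm

theorem cellLabel_injective :
    Function.Injective (cellLabel : cells (centralArrangement f) → ι → Bool) := by
  intro c c' h
  obtain ⟨x, hx, rfl⟩ := exists_cellOf_eq c
  obtain ⟨y, hy, rfl⟩ := exists_cellOf_eq c'
  rw [cellLabel_cellOf, cellLabel_cellOf] at h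
  exact Subtype.ext ((signCone_eq_iff hx hy).2 h)

theorem finite_cells [Finite ι] : Finite (cells (centralArrangement f)) :=
  Finite.of_injective _ (cellLabel_injective (f := f))

/-! ### Closures, faces and adjacency -/

open Filter Topology in
theorem closure_signCone (hx : ∀ i, f i x ≠ 0) :
    closure (signCone f x) = {w | ∀ i, 0 ≤ f i x * f i w} := by
  apply Set.Subset.antisymm
  · refine closure_minimal (fun w hw i => (hw i).le) ?_
    simp only [Set.ofPred_forall]
    exact isClosed_iInter fun i => isClosed_le continuous_const (by fun_prop)
  · intro w hw
    -- Adding a small positive multiple of `x` makes every weak inequality strict.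
    have ht : Tendsto (fun t : ℝ => w + t • x) (𝓝[>] 0) (𝓝 w) := by
      have hc : Continuous fun t : ℝ => w + t • x := by fun_prop
      simpa using (hc.tendsto 0).mono_left nhdsWithin_le_nhds
    refine mem_closure_of_tendsto ht ?_
    filter_upwards [self_mem_nhdsWithin] with t ht i
    rw [map_add, map_smul, smul_eq_mul, mul_add, mul_left_comm]
    exact add_pos_of_nonneg_of_pos (hw i) (mul_pos ht (mul_self_pos.2 (hx i)))

theorem sSameSide_ker_iff {g : E →L[ℝ] ℝ} :
    ((LinearMap.ker (g : E →ₗ[ℝ] ℝ)).toAffineSubspace).SSameSide x y ↔ 0 < g x * g y := by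
  simp only [AffineSubspace.SSameSide, AffineSubspace.WSameSide, Submodule.mem_toAffineSubspace,
    LinearMap.mem_ker, ContinuousLinearMap.coe_coe, vsub_eq_sub]
  constructor
  · rintro ⟨⟨p, hp, q, hq, hr⟩, hx, hy⟩
    have h := hr.map (g : E →ₗ[ℝ] ℝ)
    simp only [ContinuousLinearMap.coe_coe, map_sub, hp, hq, sub_zero] at h
    obtain ⟨r, s, hr, hs, h⟩ := h.exists_pos hx hy
    simp only [smul_eq_mul] at h
    have h1 : 0 < r * (g x * g x) := mul_pos hr (mul_self_pos.2 hx)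
    have h2 : s * (g x * g y) = r * (g x * g x) := by linear_combination (-g x) * h
    rw [← h2] at h1
    exact (mul_pos_iff_of_pos_left hs).1 h1
  · intro h
    have hx : g x ≠ 0 := left_ne_zero_of_mul h.ne'
    have hy : g y ≠ 0 := right_ne_zero_of_mul h.ne'
    -- The second witness is the projection of `y` to the kernel along `x`, so its difference from
    -- `y` is a multiple of `x`.
    refine ⟨⟨0, by simp, y - (g y / g x) • x, by simp [hx], ?_⟩, hx, hy⟩
    rw [sub_zero, sub_sub_cancel]
    refine SameRay.sameRay_nonneg_smul_right x ?_
    have : g y / g x = (g x * g y) / (g x * g x) := by field_simp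
    rw [this]
    exact div_nonneg h.le (mul_self_nonneg _)

theorem faceThrough_centralArrangement :
    faceThrough (centralArrangement f) z =
      {y | ∀ i, (f i z = 0 ∧ f i y = 0) ∨ 0 < f i z * f i y} := by
  ext y
  simp only [faceThrough, centralArrangement, Set.forall_mem_range, sSameSide_ker_iff,
    Submodule.mem_toAffineSubspace, LinearMap.mem_ker, ContinuousLinearMap.coe_coe]

theorem finrank_ker_add_one [FiniteDimensional ℝ E] {g : E →L[ℝ] ℝ} (hx : g x ≠ 0) :
    Module.finrank ℝ (LinearMap.ker (g : E →ₗ[ℝ] ℝ)) + 1 = Module.finrank ℝ E := by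
  apply Module.Dual.finrank_ker_add_one_of_ne_zero (f := (g : E →ₗ[ℝ] ℝ))
  intro h
  exact hx (by simpa using LinearMap.congr_fun h x)

open Filter Topology in
/-- Two cells are adjacent when exactly one hyperplane separates them. -/
theorem cellGraph_adj_iff [Finite ι] [FiniteDimensional ℝ E]
    (hker : ∀ i j, LinearMap.ker (f i : E →ₗ[ℝ] ℝ) = LinearMap.ker (f j : E →ₗ[ℝ] ℝ) → i = j)
    (hx : ∀ i, f i x ≠ 0) (hy : ∀ i, f i y ≠ 0) :
    (cellGraph (centralArrangement f)).Adj (cellOf f x hx) (cellOf f y hy) ↔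
      ∃ i, f i x * f i y < 0 ∧ ∀ j, j ≠ i → 0 < f j x * f j y := by
  constructor
  · rintro ⟨hne, F, ⟨⟨z, rfl⟩, hdim⟩, hF⟩
    have hne' : signVector f x ≠ signVector f y := fun h =>
      hne (Subtype.ext ((signCone_eq_iff hx hy).2 h))
    -- The common facet lies weakly on both sides of each separating hyperplane, hence inside it,
    -- and by dimension spans it. Two separating hyperplanes would thus coincide.
    have hle : ∀ i, f i x * f i y < 0 →
        vectorSpan ℝ (faceThrough (centralArrangement f) z) = LinearMap.ker (f i : E →ₗ[ℝ] ℝ) := by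
      intro i hi
      have hzero : ∀ w ∈ faceThrough (centralArrangement f) z, f i w = 0 := by
        intro w hw
        have hw1 := (hF hw).1
        have hw2 := (hF hw).2
        simp only [cellOf, closure_signCone hx, closure_signCone hy] at hw1 hw2
        by_contra h0
        have h1 := mul_nonneg (hw1 i) (hw2 i)
        have h2 := mul_neg_of_neg_of_pos hi (mul_self_pos.2 h0)
        nlinarith
      have hsub : vectorSpan ℝ (faceThrough (centralArrangement f) z) ≤
          LinearMap.ker (f i : E →ₗ[ℝ] ℝ) := by
        rw [vectorSpan_def, Submodule.span_le]
        rintro _ ⟨u, hu, v, hv, rfl⟩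
        simp [hzero u hu, hzero v hv]
      refine Submodule.eq_of_le_of_finrank_eq hsub ?_
      have := finrank_ker_add_one (hx i)
      omega
    obtain ⟨i, hi⟩ := Function.ne_iff.1 hne'
    have hi := (signVector_ne_iff hx hy).1 hi
    refine ⟨i, hi, fun j hj => ?_⟩
    by_contra hneg
    have hj' : f j x * f j y < 0 :=
      lt_of_le_of_ne (not_lt.1 hneg) (mul_ne_zero (hx j) (hy j))
    exact hj (hker _ _ ((hle j hj').symm.trans (hle i hi)))
  · rintro ⟨i, hi, hj⟩
    refine ⟨fun h => ?_, ?_⟩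
    · have h := (signCone_eq_iff hx hy).1 (congrArg Subtype.val h)
      exact (signVector_ne_iff hx hy).2 hi (congrFun h i)
    obtain ⟨z, hzi, hzx, hzy⟩ : ∃ z, f i z = 0 ∧ (∀ j, j ≠ i → 0 < f j x * f j z) ∧
        ∀ j, j ≠ i → 0 < f j y * f j z := by
      -- Up to a positive factor, this is the point where the segment from `x` to `y` crosses the
      -- kernel of `f i`; both weights are positive.
      refine ⟨(-(f i x * f i y)) • x + (f i x * f i x) • y, ?_, fun j hji => ?_, fun j hji => ?_⟩
      · simp only [map_add, map_smul, smul_eq_mul]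
        ring
      · have h1 := mul_pos (neg_pos.2 hi) (mul_self_pos.2 (hx j))
        have h2 := mul_pos (mul_self_pos.2 (hx i)) (hj j hji)
        simp only [map_add, map_smul, smul_eq_mul]
        linarith
      · have h1 := mul_pos (neg_pos.2 hi) (hj j hji)
        have h2 := mul_pos (mul_self_pos.2 (hx i)) (mul_self_pos.2 (hy j))
        simp only [map_add, map_smul, smul_eq_mul]
        linarith
    have hzne : ∀ j, j ≠ i → f j z ≠ 0 := fun j hji h0 => by simpa [h0] using hzx j hji
    have hface : ∀ w, w ∈ faceThrough (centralArrangement f) z ↔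
        f i w = 0 ∧ ∀ j, j ≠ i → 0 < f j z * f j w := by
      intro w
      rw [faceThrough_centralArrangement]
      constructor
      · intro h
        refine ⟨(h i).elim And.right fun h => by simp [hzi] at h, fun j hji => ?_⟩
        exact (h j).resolve_left fun h => hzne j hji h.1
      · rintro ⟨h1, h2⟩ j
        by_cases hji : j = i
        · subst hji
          exact Or.inl ⟨hzi, h1⟩
        · exact Or.inr (h2 j hji)
    have hzF : z ∈ faceThrough (centralArrangement f) z :=
      (hface z).2 ⟨hzi, fun j hji => mul_self_pos.2 (hzne j hji)⟩
    have hprod : ∀ a b c : ℝ, 0 < a * b → 0 < b * c → 0 ≤ a * c := by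
      intro a b c h1 h2
      have h3 := mul_pos h1 h2
      have h4 : 0 < (b * b) * (a * c) := by linarith
      exact (pos_of_mul_pos_right h4 (mul_self_nonneg b)).le
    refine ⟨_, ⟨⟨z, rfl⟩, ?_⟩, fun w hw => ?_⟩
    · suffices h : vectorSpan ℝ (faceThrough (centralArrangement f) z) =
          LinearMap.ker (f i : E →ₗ[ℝ] ℝ) by
        rw [h, finrank_ker_add_one (hx i)]
      apply le_antisymm
      · rw [vectorSpan_def, Submodule.span_le]
        rintro _ ⟨u, hu, v, hv, rfl⟩
        simp [((hface u).1 hu).1, ((hface v).1 hv).1]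
      · intro v hv
        have hv : f i v = 0 := by simpa using hv
        -- Small displacements of `z` within the kernel of `f i` stay in the face, so its direction
        -- space is the whole kernel.
        have hev : ∀ᶠ t in 𝓝[>] (0 : ℝ), ∀ j, j ≠ i → 0 < f j z * f j (z + t • v) :=
          eventually_all.2 fun j => by
            by_cases hji : j = i
            · simp [hji]
            · simpa [hji] using eventually_pos_mul_apply v (mul_self_pos.2 (hzne j hji))
        obtain ⟨t, ht, htpos⟩ := (hev.and self_mem_nhdsWithin).exists
        have hmem : z + t • v ∈ faceThrough (centralArrangement f) z :=
          (hface _).2 ⟨by simp [hzi, hv], ht⟩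
        have := vsub_mem_vectorSpan ℝ hmem hzF
        rw [vsub_eq_sub, add_sub_cancel_left] at this
        exact (Submodule.smul_mem_iff _ (ne_of_gt htpos)).1 this
    · obtain ⟨hwi, hwj⟩ := (hface w).1 hw
      simp only [cellOf, closure_signCone hx, closure_signCone hy]
      constructor <;> intro j <;> by_cases hji : j = i
      · simp [hji, hwi]
      · exact hprod _ _ _ (hzx j hji) (hwj j hji)
      · simp [hji, hwi]
      · exact hprod _ _ _ (hzy j hji) (hwj j hji)

/-! ### Walls of simplicial cones -/

open Filter Topology in
/-- Each facet of a simplicial cone of the arrangement lies on exactly one hyperplane, and there is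
a cell on the other side of it. -/
theorem exists_wall [Finite ι] {κ : Type*} [Fintype κ] [DecidableEq κ] (b : Module.Basis κ ℝ E)
    (hker : ∀ i j, LinearMap.ker (f i : E →ₗ[ℝ] ℝ) = LinearMap.ker (f j : E →ₗ[ℝ] ℝ) → i = j)
    (hx : ∀ i, f i x ≠ 0) (hb : signCone f x = {y | ∀ k, 0 < b.coord k y}) (k : κ) :
    ∃ i, 0 < f i x * f i (b k) ∧ (∀ y, f i y = f i (b k) * b.coord k y) ∧
      ∃ y, f i x * f i y < 0 ∧ ∀ j, j ≠ i → 0 < f j x * f j y := by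
  have hmem : ∀ y, (∀ i, 0 < f i x * f i y) ↔ ∀ k, 0 < b.coord k y := fun y =>
    Set.ext_iff.1 hb y
  have hnonneg : ∀ i j, 0 ≤ f i x * f i (b j) := by
    intro i j
    by_contra hneg
    -- Adding a small multiple of the sum of the basis puts `b j` into the open cone, yet a wrong
    -- sign at `b j` would persist.
    have h : 0 < (-f i x) * f i (b j) := by linarith
    obtain ⟨t, ht, htpos⟩ :=
      ((eventually_pos_mul_apply (∑ l, b l) h).and self_mem_nhdsWithin).exists
    have htpos : 0 < t := htpos
    have h2 := (hmem (b j + t • ∑ l, b l)).2 (fun l => by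
      simp only [Module.Basis.coord_apply, map_add, map_smul, map_sum, Module.Basis.repr_self,
        Finsupp.single_apply, Finset.sum_ite_eq', Finset.mem_univ, if_true, smul_eq_mul, mul_one]
      split_ifs <;> linarith) i
    linarith
  -- A relative interior point of the facet opposite `b k`: a functional vanishing at `p` kills
  -- every other basis vector, since the terms of the sum all have the same weak sign.
  set p : E := ∑ j ∈ Finset.univ.erase k, b j with hp
  have hsum : ∀ i, f i x * f i p = ∑ j ∈ Finset.univ.erase k, f i x * f i (b j) := by
    intro i
    rw [hp, map_sum, Finset.mul_sum]
  have hpnonneg : ∀ i, 0 ≤ f i x * f i p := fun i => by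
    rw [hsum]
    exact Finset.sum_nonneg fun j _ => hnonneg i j
  have hform : ∀ i, f i p = 0 → ∀ y, f i y = f i (b k) * b.coord k y := by
    intro i hi y
    have h0 : ∑ j ∈ Finset.univ.erase k, f i x * f i (b j) = 0 := by rw [← hsum, hi, mul_zero]
    rw [Finset.sum_eq_zero_iff_of_nonneg fun j _ => hnonneg i j] at h0
    have hj : ∀ j, j ≠ k → f i (b j) = 0 := fun j hjk =>
      (mul_eq_zero.1 (h0 j (by simp [hjk]))).resolve_left (hx i)
    conv_lhs => rw [← b.sum_repr y]
    rw [map_sum, Finset.sum_eq_single k]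
    · simp [mul_comm]
    · intro j _ hjk
      simp [hj j hjk]
    · simp
  have hbk : ∀ i, f i p = 0 → f i (b k) ≠ 0 := fun i hi h0 => hx i (by
    rw [hform i hi, h0, zero_mul])
  have hkercoord : ∀ i, f i p = 0 →
      LinearMap.ker (f i : E →ₗ[ℝ] ℝ) = LinearMap.ker (b.coord k) := by
    intro i hi
    ext y
    rw [LinearMap.mem_ker, LinearMap.mem_ker, ContinuousLinearMap.coe_coe, hform i hi,
      mul_eq_zero]
    simp [hbk i hi]
  have hcoordp : b.coord k p = 0 := by
    rw [hp, map_sum]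
    exact Finset.sum_eq_zero fun j hj => by simp [(Finset.mem_erase.1 hj).1]
  -- Otherwise `p - t • b k` would keep all signs of `x` for small `t > 0`, although its `k`-th
  -- coordinate is `-t`.
  obtain ⟨i, hi⟩ : ∃ i, f i p = 0 := by
    by_contra! hne
    have hev : ∀ᶠ t in 𝓝[>] (0 : ℝ), ∀ i, 0 < f i x * f i (p + t • (-b k)) :=
      eventually_all.2 fun i => eventually_pos_mul_apply _
        (lt_of_le_of_ne (hpnonneg i) (mul_ne_zero (hx i) (hne i)).symm)
    obtain ⟨t, ht, htpos⟩ := (hev.and self_mem_nhdsWithin).exists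
    have htpos : 0 < t := htpos
    have h := (hmem _).1 ht k
    rw [map_add, hcoordp] at h
    simp at h
    linarith
  have hposk : 0 < f i x * f i (b k) :=
    lt_of_le_of_ne (hnonneg i k) (mul_ne_zero (hx i) (hbk i hi)).symm
  refine ⟨i, hposk, hform i hi, ?_⟩
  -- A second functional vanishing at `p` would have the same kernel, that of the `k`-th coordinate.
  have hother : ∀ j, j ≠ i → 0 < f j x * f j p := fun j hji =>
    lt_of_le_of_ne (hpnonneg j) (mul_ne_zero (hx j) fun h0 =>
      hji (hker _ _ ((hkercoord j h0).trans (hkercoord i hi).symm))).symm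
  have hev : ∀ᶠ t in 𝓝[>] (0 : ℝ), ∀ j, j ≠ i → 0 < f j x * f j (p + t • (-b k)) :=
    eventually_all.2 fun j => by
      by_cases hji : j = i
      · simp [hji]
      · simpa only [hji, ne_eq, not_false_eq_true, true_imp_iff] using
          eventually_pos_mul_apply (-b k) (hother j hji)
  obtain ⟨t, ht, htpos⟩ := (hev.and self_mem_nhdsWithin).exists
  have htpos : 0 < t := htpos
  refine ⟨_, ?_, ht⟩
  have := mul_pos htpos hposk
  simp only [map_add, map_smul, map_neg, hi, smul_eq_mul]
  linarith

theorem ne_zero_of_signs {i : ι} (h : f i x * f i y < 0) (h' : ∀ j, j ≠ i → 0 < f j x * f j y)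
    (j : ι) : f j y ≠ 0 := by
  by_cases hji : j = i
  · subst hji
    exact right_ne_zero_of_mul h.ne
  · exact right_ne_zero_of_mul (h' j hji).ne'

/-! ### Distance and degree in simplicial cell graphs -/

/-- Every cell of the arrangement is the open cone spanned by a basis indexed by `κ`. -/
def IsSimplicialBy (κ : Type*) (f : ι → E →L[ℝ] ℝ) : Prop :=
  ∀ x, (∀ i, f i x ≠ 0) → ∃ b : Module.Basis κ ℝ E, signCone f x = {y | ∀ k, 0 < b.coord k y}

variable {κ : Type*} [Fintype κ] [DecidableEq κ]

/-- The cell graph of a simplicial central arrangement is isometrically labelled by signs. -/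
theorem cellGraph_dist_eq [Fintype ι] [FiniteDimensional ℝ E]
    (hker : ∀ i j, LinearMap.ker (f i : E →ₗ[ℝ] ℝ) = LinearMap.ker (f j : E →ₗ[ℝ] ℝ) → i = j)
    (hs : IsSimplicialBy κ f) (hne : ∃ x, ∀ i, f i x ≠ 0) :
    (cellGraph (centralArrangement f)).Connected ∧
      ∀ c c', (cellGraph (centralArrangement f)).dist c c' =
        hammingDist (cellLabel c) (cellLabel c') := by
  obtain ⟨x₀, hx₀⟩ := hne
  have : Nonempty (cells (centralArrangement f)) := ⟨cellOf f x₀ hx₀⟩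
  apply SimpleGraph.dist_eq_hammingDist
  · intro c c' h
    obtain ⟨x, hx, rfl⟩ := exists_cellOf_eq c
    obtain ⟨y, hy, rfl⟩ := exists_cellOf_eq c'
    obtain ⟨i, -, hj⟩ := (cellGraph_adj_iff hker hx hy).1 h
    rw [cellLabel_cellOf, cellLabel_cellOf]
    refine (Finset.card_le_card (t := {i}) fun j hj' => ?_).trans (Finset.card_singleton i).le
    rw [Finset.mem_singleton]
    by_contra hji
    exact (Finset.mem_filter.1 hj').2 ((signVector_eq_iff hx hy).2 (hj j hji))
  · intro c c' hcc
    obtain ⟨x, hx, rfl⟩ := exists_cellOf_eq c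
    obtain ⟨y, hy, rfl⟩ := exists_cellOf_eq c'
    obtain ⟨b, hb⟩ := hs x hx
    have hy' : y ∉ signCone f x := fun h => hcc (Subtype.ext (signCone_eq_of_mem h))
    rw [hb] at hy'
    simp only [Set.mem_ofPred_eq, not_forall, not_lt] at hy'
    obtain ⟨k, hk⟩ := hy'
    obtain ⟨i, hpos, hform, u, hui, huj⟩ := exists_wall b hker hx hb k
    have hu := ne_zero_of_signs hui huj
    refine ⟨cellOf f u hu, (cellGraph_adj_iff hker hx hu).2 ⟨i, hui, huj⟩, ?_⟩
    -- The wall of a coordinate that is not positive at `y` separates `y` from `x`; crossing it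
    -- removes one disagreement and creates none.
    have hyi : f i x * f i y < 0 := by
      refine lt_of_le_of_ne ?_ (mul_ne_zero (hx i) (hy i))
      rw [hform y, ← mul_assoc]
      exact mul_nonpos_of_nonneg_of_nonpos hpos.le hk
    simp only [cellLabel_cellOf]
    apply Finset.card_lt_card
    have hxu := (signVector_ne_iff hx hu).2 hui
    have hxy := (signVector_ne_iff hx hy).2 hyi
    refine Finset.ssubset_iff_of_subset ?_ |>.2 ⟨i, by simpa using hxy, ?_⟩
    · intro j hj
      rw [Finset.mem_filter] at hj ⊢
      refine ⟨hj.1, ?_⟩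
      by_cases hji : j = i
      · rwa [hji]
      · rw [(signVector_eq_iff hx hu).2 (huj j hji)]
        exact hj.2
    · simp only [Finset.mem_filter, Finset.mem_univ, true_and, not_not]
      revert hxu hxy
      cases signVector f x i <;> cases signVector f y i <;> cases signVector f u i <;> simp

/-- In a simplicial central arrangement the cells are regular of degree the dimension. -/
theorem ncard_neighborSet_cellGraph [Finite ι] [FiniteDimensional ℝ E]
    (hker : ∀ i j, LinearMap.ker (f i : E →ₗ[ℝ] ℝ) = LinearMap.ker (f j : E →ₗ[ℝ] ℝ) → i = j)
    (hs : IsSimplicialBy κ f) (c : cells (centralArrangement f)) :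
    ((cellGraph (centralArrangement f)).neighborSet c).ncard = Fintype.card κ := by
  obtain ⟨x, hx, rfl⟩ := exists_cellOf_eq c
  obtain ⟨b, hb⟩ := hs x hx
  choose w hpos hform u hui huj using exists_wall b hker hx hb
  have hu := fun k => ne_zero_of_signs (hui k) (huj k)
  have hw : Function.Injective w := by
    intro k l hkl
    by_contra hne
    have h := hform k (b l)
    rw [Module.Basis.coord_apply, Module.Basis.repr_self, Finsupp.single_eq_of_ne hne,
      mul_zero, hkl] at h
    simpa [h] using hpos l
  have hinj : Function.Injective fun k => cellOf f (u k) (hu k) := by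
    intro k l hkl
    by_contra hne
    have h := (signCone_eq_iff (hu k) (hu l)).1 (congrArg Subtype.val hkl)
    have h1 := (signVector_ne_iff hx (hu k)).2 (hui k)
    have h2 := (signVector_eq_iff hx (hu l)).2 (huj l (w k) (fun h => hne (hw h)))
    exact h1 (h2.trans (congrFun h (w k)).symm)
  have hrange : (cellGraph (centralArrangement f)).neighborSet (cellOf f x hx) =
      Set.range fun k => cellOf f (u k) (hu k) := by
    ext c'
    rw [SimpleGraph.mem_neighborSet]
    constructor
    · intro h
      obtain ⟨y, hy, rfl⟩ := exists_cellOf_eq c'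
      obtain ⟨i, hi, hj⟩ := (cellGraph_adj_iff hker hx hy).1 h
      have hy' : y ∉ signCone f x := fun h => (h i).not_gt hi
      rw [hb] at hy'
      simp only [Set.mem_ofPred_eq, not_forall, not_lt] at hy'
      obtain ⟨k, hk⟩ := hy'
      -- The wall `w k` separates `x` from `y`, and only `i` does.
      have hwi : w k = i := by
        by_contra hne
        have h1 := hj _ hne
        rw [hform k y, ← mul_assoc] at h1
        exact h1.not_ge (mul_nonpos_of_nonneg_of_nonpos (hpos k).le hk)
      refine ⟨k, Subtype.ext ((signCone_eq_iff (hu k) hy).2 (funext fun j => ?_))⟩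
      by_cases hji : j = i
      · have h1 := (signVector_ne_iff hx (hu k)).2 (hui k)
        have h2 := (signVector_ne_iff hx hy).2 hi
        rw [hwi] at h1
        rw [hji]
        revert h1 h2
        cases signVector f x i <;> cases signVector f y i <;> cases signVector f (u k) i <;> simp
      · rw [← (signVector_eq_iff hx (hu k)).2 (huj k j (hwi ▸ hji)),
          ← (signVector_eq_iff hx hy).2 (hj j hji)]
    · rintro ⟨k, rfl⟩
      exact (cellGraph_adj_iff hker hx (hu k)).2 ⟨w k, hui k, huj k⟩
  rw [hrange, Set.ncard_range_of_injective hinj, Nat.card_eq_fintype_card]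

end HyperplaneArrangement

/-! ### Topology of the projective plane -/

namespace LineArrangement

open HyperplaneArrangement (signCone centralArrangement cellOf cellLabel signVector)

/-- The set of the projective points represented by the nonzero vectors of a set. -/
def projImage (S : Set R3) : Set (ℙ ℝ R3) :=
  {p | ∃ v, ∃ hv : v ≠ 0, v ∈ S ∧ p = Projectivization.mk ℝ v hv}

theorem continuous_mk' : Continuous (Projectivization.mk' ℝ : {v : R3 // v ≠ 0} → ℙ ℝ R3) :=
  continuous_coinduced_rng

theorem surjective_mk' :
    Function.Surjective (Projectivization.mk' ℝ : {v : R3 // v ≠ 0} → ℙ ℝ R3) :=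
  fun p => p.ind fun v hv => ⟨⟨v, hv⟩, rfl⟩

/-- Makes the whole plane the only cell of the empty arrangement, which is then excluded as not
being a triangle. -/
instance : PreconnectedSpace (ℙ ℝ R3) := by
  have h : IsConnected ({0}ᶜ : Set R3) :=
    isConnected_compl_singleton_of_one_lt_rank (by simp) 0
  have : PreconnectedSpace {v : R3 // v ≠ 0} := Subtype.preconnectedSpace h.isPreconnected
  exact ⟨surjective_mk'.range_eq ▸ isPreconnected_range continuous_mk'⟩

theorem projImage_eq_image (S : Set R3) :
    projImage S = Projectivization.mk' ℝ '' (Subtype.val ⁻¹' S : Set {v : R3 // v ≠ 0}) := by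
  ext p
  constructor
  · rintro ⟨v, hv, hS, rfl⟩
    exact ⟨⟨v, hv⟩, hS, rfl⟩
  · rintro ⟨v, hS, rfl⟩
    exact ⟨v.1, v.2, hS, rfl⟩

theorem isPreconnected_projImage {S : Set R3} (h0 : 0 ∉ S) (hS : IsPreconnected S) :
    IsPreconnected (projImage S) := by
  rw [projImage_eq_image]
  refine IsPreconnected.image ?_ _ continuous_mk'.continuousOn
  have hind : Topology.IsInducing (Subtype.val : {v : R3 // v ≠ 0} → R3) := .subtypeVal
  rw [← hind.isPreconnected_image]
  convert hS using 1
  ext v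
  constructor
  · rintro ⟨w, hw, rfl⟩
    exact hw
  · exact fun hv => ⟨⟨v, fun h => h0 (h ▸ hv)⟩, hv, rfl⟩

/-! ### Functionals of lines and the lifted arrangement -/

/-- A functional whose kernel is the plane of a projective line. -/
theorem exists_functional (L : ProjLine) :
    ∃ g : R3 →L[ℝ] ℝ, LinearMap.ker (g : R3 →ₗ[ℝ] ℝ) = L.1.submodule := by
  have hlt : L.1.submodule < ⊤ := lt_top_iff_ne_top.2 fun h => by
    have h2 := L.2
    rw [h, finrank_top] at h2
    simp at h2
  obtain ⟨g, hg, hle⟩ := Submodule.exists_le_ker_of_lt_top _ hlt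
  refine ⟨LinearMap.toContinuousLinearMap g, (Submodule.eq_of_le_of_finrank_eq hle ?_).symm⟩
  have h := Module.Dual.finrank_ker_add_one_of_ne_zero hg
  rw [Module.finrank_fin_fun] at h
  rw [L.2]
  omega

/-- A chosen functional whose kernel is the plane of a projective line. -/
noncomputable def functional (L : ProjLine) : R3 →L[ℝ] ℝ := (exists_functional L).choose

theorem ker_functional (L : ProjLine) :
    LinearMap.ker (functional L : R3 →ₗ[ℝ] ℝ) = L.1.submodule :=
  (exists_functional L).choose_spec

theorem mk_mem_iff (L : ProjLine) {v : R3} (hv : v ≠ 0) :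
    Projectivization.mk ℝ v hv ∈ L.1 ↔ functional L v = 0 := by
  rw [← Projectivization.Subspace.mem_submodule_iff, ← ker_functional]
  simp

/-- The functionals of the lines of an arrangement. -/
noncomputable def functionals (A : Finset ProjLine) (L : A) : R3 →L[ℝ] ℝ := functional L.1

variable {A : Finset ProjLine}

theorem functionals_ker_injective (L L' : A)
    (h : LinearMap.ker (functionals A L : R3 →ₗ[ℝ] ℝ) =
      LinearMap.ker (functionals A L' : R3 →ₗ[ℝ] ℝ)) : L = L' := by
  unfold functionals at h
  rw [ker_functional, ker_functional] at h
  exact Subtype.ext (Subtype.ext (Projectivization.Subspace.submodule.injective h))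

theorem finrank_horizontalPlane : Module.finrank ℝ horizontalPlane = 2 := by
  have h := Module.Dual.finrank_ker_add_one_of_ne_zero
    (f := (LinearMap.proj (2 : Fin 3) : R3 →ₗ[ℝ] ℝ)) (fun h => by
      simpa using LinearMap.congr_fun h (fun _ => 1))
  rw [Module.finrank_fin_fun] at h
  exact Nat.succ_injective h

theorem affineSpan_affineTrace {L : ProjLine} (hL : L.1 ≠ lineAtInfinity) :
    affineSpan ℝ (insert 0 (affineTrace L)) = L.1.submodule.toAffineSubspace := by
  have htrace : affineTrace L = {v | v 2 = 1 ∧ v ∈ L.1.submodule} := by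
    ext v
    refine and_congr_right fun h => ?_
    have hv : v ≠ 0 := by
      rintro rfl
      simp at h
    rw [Projectivization.Subspace.mem_submodule_iff _ hv]
    exact ⟨fun h => h.2, fun h => ⟨hv, h⟩⟩
  obtain ⟨u, hu, hu1⟩ : ∃ u ∈ L.1.submodule, u 2 = 1 := by
    by_contra! hno
    have hle : L.1.submodule ≤ horizontalPlane := by
      intro v hv
      by_contra h
      have h : v 2 ≠ 0 := h
      exact hno ((v 2)⁻¹ • v) (Submodule.smul_mem _ _ hv) (by simp [h])
    have heq := Submodule.eq_of_le_of_finrank_eq hle (by rw [L.2, finrank_horizontalPlane])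
    exact hL (by rw [lineAtInfinity, ← heq, OrderIso.symm_apply_apply])
  apply SetLike.coe_injective
  rw [affineSpan_insert_zero, htrace]
  refine congrArg (fun W : Submodule ℝ R3 => (W : Set R3)) ?_
  apply le_antisymm
  · exact Submodule.span_le.2 fun v hv => hv.2
  · intro v hv
    have hu' : u ∈ Submodule.span ℝ {v : R3 | v 2 = 1 ∧ v ∈ L.1.submodule} :=
      Submodule.subset_span ⟨hu1, hu⟩
    -- Correcting `v` by a multiple of `u` brings it to height one, so `v` is a combination of
    -- vectors of the trace.
    have hw : v + (1 - v 2) • u ∈ Submodule.span ℝ {v : R3 | v 2 = 1 ∧ v ∈ L.1.submodule} :=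
      Submodule.subset_span
        ⟨by simp [hu1], Submodule.add_mem _ hv (Submodule.smul_mem _ _ hu)⟩
    simpa using Submodule.sub_mem _ hw (Submodule.smul_mem _ (1 - v 2) hu')

theorem lift_eq_centralArrangement (A : Finset ProjLine) :
    lift A = centralArrangement (functionals A) := by
  ext H
  simp only [lift, centralArrangement, functionals, ker_functional, Set.mem_union, Set.mem_range]
  constructor
  · rintro (⟨L, hLA, hL, rfl⟩ | ⟨⟨L, hLA, hL⟩, rfl⟩)
    · exact ⟨⟨L, hLA⟩, (affineSpan_affineTrace hL).symm⟩
    · refine ⟨⟨L, hLA⟩, ?_⟩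
      simp only [hL, lineAtInfinity, OrderIso.apply_symm_apply]
  · rintro ⟨⟨L, hLA⟩, rfl⟩
    by_cases hL : L.1 = lineAtInfinity
    · refine Or.inr ⟨⟨L, hLA, hL⟩, ?_⟩
      simp only [hL, lineAtInfinity, OrderIso.apply_symm_apply]
    · exact Or.inl ⟨L, hLA, hL, (affineSpan_affineTrace hL).symm⟩

/-! ### Cells of the projective arrangement -/

theorem mk_mem_complement_iff {v : R3} (hv : v ≠ 0) :
    Projectivization.mk ℝ v hv ∈ complement A ↔ ∀ L, functionals A L v ≠ 0 := by
  simp only [complement, functionals]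
  exact ⟨fun h L h0 => h L.1 L.2 ((mk_mem_iff _ hv).2 h0),
    fun h L hL hm => h ⟨L, hL⟩ ((mk_mem_iff _ hv).1 hm)⟩

/-- Representatives differ by a nonzero scalar; a positive one preserves each sign cone and a
negative one exchanges it with its opposite. -/
theorem mk_mem_projImage_iff {ι : Type*} {f : ι → R3 →L[ℝ] ℝ} {x v : R3} (hv : v ≠ 0) :
    Projectivization.mk ℝ v hv ∈ projImage (signCone f x) ↔
      v ∈ signCone f x ∨ v ∈ signCone f (-x) := by
  constructor
  · rintro ⟨w, hw, hwx, h⟩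
    obtain ⟨a, rfl⟩ := (Projectivization.mk_eq_mk_iff' ℝ _ _ hv hw).1 h
    have ha : a ≠ 0 := by
      rintro rfl
      simp at hv
    rcases lt_or_gt_of_ne ha with ha | ha
    · right
      rw [← HyperplaneArrangement.neg_mem_signCone_iff, ← neg_smul]
      exact (HyperplaneArrangement.smul_mem_signCone_iff (neg_pos.2 ha)).2 hwx
    · exact Or.inl ((HyperplaneArrangement.smul_mem_signCone_iff ha).2 hwx)
  · rintro (h | h)
    · exact ⟨v, hv, h, rfl⟩
    · refine ⟨-v, neg_ne_zero.2 hv, HyperplaneArrangement.neg_mem_signCone_iff.2 h, ?_⟩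
      exact (Projectivization.mk_eq_mk_iff' ℝ _ _ _ _).2 ⟨-1, by simp⟩

theorem isOpen_projImage {ι : Type*} [Finite ι] (f : ι → R3 →L[ℝ] ℝ) (x : R3) :
    IsOpen (projImage (signCone f x)) := by
  rw [isOpen_coinduced]
  have h : Projectivization.mk' ℝ ⁻¹' projImage (signCone f x) =
      (Subtype.val ⁻¹' (signCone f x ∪ signCone f (-x)) : Set {v : R3 // v ≠ 0}) := by
    ext v
    exact mk_mem_projImage_iff v.2
  rw [h]
  exact (HyperplaneArrangement.isOpen_signCone.union
    HyperplaneArrangement.isOpen_signCone).preimage continuous_subtype_val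

theorem ne_zero_of_functionals [Nonempty A] {x : R3} (hx : ∀ L, functionals A L x ≠ 0) :
    x ≠ 0 := by
  rintro rfl
  exact hx (Classical.arbitrary A) (map_zero _)

/-- The cells of a nonempty projective arrangement are the images of the sign cones. -/
theorem connectedComponentIn_mk [Nonempty A] {x : R3} (hx : ∀ L, functionals A L x ≠ 0) :
    connectedComponentIn (complement A) (Projectivization.mk ℝ x (ne_zero_of_functionals hx)) =
      projImage (signCone (functionals A) x) := by
  have hself : Projectivization.mk ℝ x (ne_zero_of_functionals hx) ∈
      projImage (signCone (functionals A) x) :=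
    ⟨x, _, HyperplaneArrangement.self_mem_signCone hx, rfl⟩
  have hmem := (mk_mem_complement_iff (ne_zero_of_functionals hx)).2 hx
  apply Set.Subset.antisymm
  -- The images of the cones other than those of `x` and `-x` form an open set disjoint from the
  -- image of the cone of `x`, and together they cover the complement.
  · refine IsPreconnected.subset_left_of_subset_union
      (v := ⋃ y ∈ {y | (∀ L, functionals A L y ≠ 0) ∧ y ∉ signCone (functionals A) x ∧
        y ∉ signCone (functionals A) (-x)}, projImage (signCone (functionals A) y))
      (isOpen_projImage _ _) (isOpen_biUnion fun _ _ => isOpen_projImage _ _) ?_ ?_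
      ⟨_, mem_connectedComponentIn hmem, hself⟩ isPreconnected_connectedComponentIn
    · rw [Set.disjoint_iUnion₂_right]
      rintro y ⟨hy, hyx, hyx'⟩
      rw [Set.disjoint_left]
      rintro _ ⟨v, hv, hvx, rfl⟩ h
      rcases (mk_mem_projImage_iff hv).1 h with h | h
      · apply hyx
        rw [HyperplaneArrangement.signCone_eq_of_mem hvx,
          ← HyperplaneArrangement.signCone_eq_of_mem h]
        exact HyperplaneArrangement.self_mem_signCone hy
      · apply hyx'
        rw [← HyperplaneArrangement.neg_mem_signCone_iff,
          HyperplaneArrangement.signCone_eq_of_mem hvx,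
          ← HyperplaneArrangement.signCone_eq_of_mem h]
        exact HyperplaneArrangement.self_mem_signCone fun L => by simpa using hy L
    · intro p hp
      have hp := connectedComponentIn_subset _ _ hp
      induction p using Projectivization.ind with
      | h v hv =>
        have hv' := (mk_mem_complement_iff hv).1 hp
        by_cases h : Projectivization.mk ℝ v hv ∈ projImage (signCone (functionals A) x)
        · exact Or.inl h
        · rw [mk_mem_projImage_iff hv, not_or] at h
          exact Or.inr (Set.mem_iUnion₂.2
            ⟨v, ⟨hv', h⟩, v, hv, HyperplaneArrangement.self_mem_signCone hv', rfl⟩)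
  · refine (isPreconnected_projImage ?_
      HyperplaneArrangement.convex_signCone.isPreconnected).subset_connectedComponentIn hself ?_
    · exact fun h => HyperplaneArrangement.ne_zero_of_mem_signCone h (Classical.arbitrary A)
        (map_zero _)
    · rintro _ ⟨v, hv, hvx, rfl⟩
      exact (mk_mem_complement_iff hv).2 (HyperplaneArrangement.ne_zero_of_mem_signCone hvx)

theorem mem_cells_iff [Nonempty A] {c : Set (ℙ ℝ R3)} :
    c ∈ cells A ↔ ∃ x, (∀ L, functionals A L x ≠ 0) ∧
      c = projImage (signCone (functionals A) x) := by
  constructor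
  · rintro ⟨p, hp, rfl⟩
    induction p using Projectivization.ind with
    | h v hv =>
      have hv' := (mk_mem_complement_iff hv).1 hp
      exact ⟨v, hv', connectedComponentIn_mk hv'⟩
  · rintro ⟨x, hx, rfl⟩
    exact ⟨_, (mk_mem_complement_iff (ne_zero_of_functionals hx)).2 hx,
      (connectedComponentIn_mk hx).symm⟩

/-! ### Triangles and simplicial cones -/

theorem IsTriangle.exists_basis {c : Set (ℙ ℝ R3)} (h : IsTriangle c) :
    ∃ b : Module.Basis (Fin 3) ℝ R3, ∀ v hv, Projectivization.mk ℝ v hv ∈ c ↔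
      (∀ k, 0 < b.coord k v) ∨ ∀ k, 0 < b.coord k (-v) := by
  obtain ⟨b, hb, rfl⟩ := h
  set B := basisOfLinearIndependentOfCardEqFinrank hb (by simp) with hB
  have hBb : ∀ i, b i = B i := fun i => by simp [hB]
  have hcoord : ∀ (t : Fin 3 → ℝ) k, B.coord k (∑ i, t i • b i) = t k := by
    intro t k
    simp only [hBb, Module.Basis.coord_apply, Module.Basis.repr_sum_self]
  have hsum : ∀ v : R3, ∑ i, B.coord i v • b i = v := by
    intro v
    simp only [hBb, Module.Basis.coord_apply, Module.Basis.sum_repr]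
  refine ⟨B, fun v hv => ⟨?_, ?_⟩⟩
  · rintro ⟨t, ht0, htpos, h⟩
    obtain ⟨a, rfl⟩ := (Projectivization.mk_eq_mk_iff' ℝ _ _ hv ht0).1 h
    have ha : a ≠ 0 := by
      rintro rfl
      simp at hv
    rcases lt_or_gt_of_ne ha with ha | ha
    · right
      intro k
      rw [← neg_smul, map_smul, hcoord, smul_eq_mul]
      exact mul_pos (neg_pos.2 ha) (htpos k)
    · left
      intro k
      rw [map_smul, hcoord, smul_eq_mul]
      exact mul_pos ha (htpos k)
  · rintro (h | h)
    · refine ⟨fun k => B.coord k v, by rwa [hsum], h, ?_⟩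
      simp only [hsum]
    · refine ⟨fun k => B.coord k (-v), by rwa [hsum, neg_ne_zero], h, ?_⟩
      simp only [hsum]
      exact (Projectivization.mk_eq_mk_iff' ℝ _ _ _ _).2 ⟨-1, by simp⟩

theorem IsSimplicial.nonempty (hA : IsSimplicial A) : Nonempty A := by
  rw [Finset.nonempty_coe_sort, Finset.nonempty_iff_ne_empty]
  rintro rfl
  have hcompl : complement ∅ = Set.univ := by
    ext
    simp [complement]
  have hcell : (Set.univ : Set (ℙ ℝ R3)) ∈ cells ∅ := by
    have h1 : (fun _ => 1 : R3) ≠ 0 := fun h => one_ne_zero (congrFun h 0)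
    refine ⟨Projectivization.mk ℝ _ h1, by simp [hcompl], ?_⟩
    rw [hcompl, connectedComponentIn_univ, PreconnectedSpace.connectedComponent_eq_univ]
  obtain ⟨b, hb⟩ := (hA _ hcell).exists_basis
  -- The vertex `b 0` has a vanishing coordinate, so its class is not in the open triangle.
  rcases (hb (b 0) (b.ne_zero 0)).1 (Set.mem_univ _) with h | h <;> simpa using h 1

/-- If a cone and an open simplicial cone agree up to sign and share a point, they are equal. -/
theorem eq_simplicialCone {ι : Type*} {f : ι → R3 →L[ℝ] ℝ} {x : R3}
    (b : Module.Basis (Fin 3) ℝ R3) (hx : ∀ i, f i x ≠ 0) (hxb : ∀ k, 0 < b.coord k x)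
    (h : ∀ v, v ≠ 0 → (v ∈ signCone f x ∨ -v ∈ signCone f x ↔
      (∀ k, 0 < b.coord k v) ∨ ∀ k, 0 < b.coord k (-v)))
    (h0 : 0 ∉ signCone f x) :
    signCone f x = {y | ∀ k, 0 < b.coord k y} := by
  have hopen : IsOpen {y : R3 | ∀ k, 0 < b.coord k y} := by
    simp only [Set.ofPred_forall]
    exact isOpen_iInter_of_finite fun k =>
      isOpen_lt continuous_const (LinearMap.continuous_of_finiteDimensional _)
  have hdisj : ∀ y, (∀ k, 0 < b.coord k y) → ¬ ∀ k, 0 < b.coord k (-y) := by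
    intro y hy hy'
    have h1 := hy 0
    have h2 := hy' 0
    rw [map_neg] at h2
    linarith
  have hsub : signCone f x ⊆ {y | ∀ k, 0 < b.coord k y} := by
    -- The sign cone is connected and covered by two disjoint open cones, opposite to each other; it
    -- meets the first at `x`.
    refine IsPreconnected.subset_left_of_subset_union hopen
      (hopen.preimage (continuous_neg : Continuous fun y : R3 => -y)) ?_ ?_
      ⟨x, HyperplaneArrangement.self_mem_signCone hx, hxb⟩
      HyperplaneArrangement.convex_signCone.isPreconnected
    · exact Set.disjoint_left.2 hdisj
    · intro v hv
      exact (h v fun hv0 => h0 (hv0 ▸ hv)).1 (Or.inl hv)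
  refine hsub.antisymm fun y hy => ?_
  have hy0 : y ≠ 0 := by
    rintro rfl
    simpa using hy 0
  exact ((h y hy0).2 (Or.inl hy)).resolve_right fun h' => hdisj y hy (hsub h')

/-- A triangle lifts to a pair of opposite simplicial cones; negating the basis if necessary selects
the one containing `x`. -/
theorem IsSimplicial.isSimplicialBy (hA : IsSimplicial A) :
    HyperplaneArrangement.IsSimplicialBy (Fin 3) (functionals A) := by
  have := hA.nonempty
  intro x hx
  obtain ⟨b, hb⟩ := (hA _ (mem_cells_iff.2 ⟨x, hx, rfl⟩)).exists_basis
  have h0 : 0 ∉ signCone (functionals A) x := fun h =>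
    HyperplaneArrangement.ne_zero_of_mem_signCone h (Classical.arbitrary A) (map_zero _)
  have hiff : ∀ v, v ≠ 0 → (v ∈ signCone (functionals A) x ∨ -v ∈ signCone (functionals A) x ↔
      (∀ k, 0 < b.coord k v) ∨ ∀ k, 0 < b.coord k (-v)) := by
    intro v hv
    rw [← hb v hv, mk_mem_projImage_iff, HyperplaneArrangement.neg_mem_signCone_iff]
  rcases (hiff x (ne_zero_of_functionals hx)).1
    (Or.inl (HyperplaneArrangement.self_mem_signCone hx)) with h | h
  · exact ⟨b, eq_simplicialCone b hx h hiff h0⟩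
  · have hcoord : ∀ k y, (b.map (LinearEquiv.neg ℝ)).coord k y = b.coord k (-y) := by
      intro k y
      simp
    refine ⟨_, eq_simplicialCone (b.map (LinearEquiv.neg ℝ)) hx ?_ ?_ h0⟩
    · simpa only [hcoord] using h
    · intro v hv
      rw [hiff v hv, or_comm]
      simp only [hcoord, neg_neg]

/-! ### Counting the cells -/

/-- Some point lies on no plane of the arrangement. -/
theorem exists_forall_functionals_ne_zero (A : Finset ProjLine) :
    ∃ x, ∀ L, functionals A L x ≠ 0 := by
  -- A real vector space is not a finite union of proper subspaces.
  have h := Subspace.biUnion_ne_univ_of_top_notMem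
    (s := Finset.univ.image fun L : A => LinearMap.ker (functionals A L : R3 →ₗ[ℝ] ℝ)) (by
      simp only [Finset.mem_image, Finset.mem_univ, true_and, not_exists]
      intro L hL
      have h2 := L.1.2
      rw [← ker_functional] at h2
      rw [functionals] at hL
      rw [hL, finrank_top] at h2
      simp at h2)
  obtain ⟨x, hx⟩ := (Set.ne_univ_iff_exists_notMem _).1 h
  refine ⟨x, fun L hL => hx (Set.mem_iUnion₂.2
    ⟨_, Finset.mem_image_of_mem _ (Finset.mem_univ L), ?_⟩)⟩
  simpa using hL

/-- A cell of the lifted arrangement amounts to a cell of the projective arrangement and a side of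
one of its lines. -/
noncomputable def cellsEquiv [Nonempty A] :
    HyperplaneArrangement.cells (centralArrangement (functionals A)) ≃ Bool × cells A := by
  refine Equiv.ofBijective (fun c => (cellLabel c (Classical.arbitrary A), ⟨projImage c.1, ?_⟩))
    ⟨?_, ?_⟩
  · obtain ⟨x, hx, h⟩ := HyperplaneArrangement.mem_cells_iff.1 c.2
    exact mem_cells_iff.2 ⟨x, hx, by rw [h]⟩
  · intro c c' h
    obtain ⟨x, hx, rfl⟩ := HyperplaneArrangement.exists_cellOf_eq c
    obtain ⟨y, hy, rfl⟩ := HyperplaneArrangement.exists_cellOf_eq c'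
    simp only [HyperplaneArrangement.cellLabel_cellOf, Prod.mk.injEq, Subtype.mk.injEq] at h
    have hmem : Projectivization.mk ℝ y (ne_zero_of_functionals hy) ∈
        projImage (signCone (functionals A) x) := by
      have : Projectivization.mk ℝ y (ne_zero_of_functionals hy) ∈
        projImage (signCone (functionals A) y) :=
        ⟨y, _, HyperplaneArrangement.self_mem_signCone hy, rfl⟩
      exact h.2 ▸ this
    -- Equal images leave only the cone or its opposite, and the sign of the chosen functional rules
    -- out the opposite.
    refine Subtype.ext (HyperplaneArrangement.signCone_eq_of_mem
      (((mk_mem_projImage_iff _).1 hmem).resolve_right fun hneg => ?_))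
    have h1 := (HyperplaneArrangement.signVector_eq_iff hx hy).1 h.1
    have h2 := hneg (Classical.arbitrary A)
    rw [map_neg] at h2
    linarith
  · rintro ⟨s, c, hc⟩
    obtain ⟨x, hx, rfl⟩ := mem_cells_iff.1 hc
    by_cases hs : signVector (functionals A) x (Classical.arbitrary A) = s
    · refine ⟨cellOf _ x hx, ?_⟩
      simp only [HyperplaneArrangement.cellLabel_cellOf, hs]
      rfl
    · have hx' : ∀ L, functionals A L (-x) ≠ 0 := fun L => by simpa using hx L
      refine ⟨cellOf _ (-x) hx', Prod.ext ?_ (Subtype.ext ?_)⟩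
      · have hne := (HyperplaneArrangement.signVector_ne_iff hx hx'
          (i := Classical.arbitrary A)).2 (by
            rw [map_neg]
            have := mul_self_pos.2 (hx (Classical.arbitrary A))
            linarith)
        simp only [HyperplaneArrangement.cellLabel_cellOf]
        revert hs hne
        cases s <;> cases signVector (functionals A) x (Classical.arbitrary A) <;>
          cases signVector (functionals A) (-x) (Classical.arbitrary A) <;> simp
      · ext p
        induction p using Projectivization.ind with
        | h v hv =>
          simp only [cellOf]
          rw [mk_mem_projImage_iff, mk_mem_projImage_iff, neg_neg, or_comm]

theorem IsSimplicial.triangles_eq_cells (hA : IsSimplicial A) : triangles A = cells A :=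
  Set.ext fun c => ⟨And.left, fun h => ⟨h, hA c h⟩⟩

end LineArrangement

theorem theorem1 (A : Finset ProjLine) (hA : LineArrangement.IsSimplicial A) :
    (LineArrangement.graph A).IsPartialCube ∧
    (LineArrangement.graph A).IsCubic ∧
    Finite (HyperplaneArrangement.cells (LineArrangement.lift A)) ∧
    (LineArrangement.triangles A).Finite ∧
    Nat.card (HyperplaneArrangement.cells (LineArrangement.lift A)) =
      2 * (LineArrangement.triangles A).ncard := by
  have := hA.nonempty
  unfold LineArrangement.graph
  rw [LineArrangement.lift_eq_centralArrangement, hA.triangles_eq_cells]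
  have hfin := HyperplaneArrangement.finite_cells (f := LineArrangement.functionals A)
  obtain ⟨hconn, hdist⟩ := HyperplaneArrangement.cellGraph_dist_eq
    LineArrangement.functionals_ker_injective hA.isSimplicialBy
    (LineArrangement.exists_forall_functionals_ne_zero A)
  refine ⟨⟨hconn, A.card, fun c k => HyperplaneArrangement.cellLabel c (A.equivFin.symm k),
    fun c c' => ?_⟩, fun c => ?_, hfin, ?_, ?_⟩
  · rw [hdist, hammingDist_comp_equiv A.equivFin.symm]
  · simpa using HyperplaneArrangement.ncard_neighborSet_cellGraph
      LineArrangement.functionals_ker_injective hA.isSimplicialBy c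
  · have : Finite (Bool × LineArrangement.cells A) :=
      Finite.of_equiv _ (LineArrangement.cellsEquiv (A := A))
    exact Set.finite_coe_iff.1 (Finite.of_surjective (Prod.snd : Bool × LineArrangement.cells A → _)
      Prod.snd_surjective)
  · rw [Nat.card_congr (LineArrangement.cellsEquiv (A := A)), Nat.card_prod,
      Nat.card_eq_fintype_card,
      Fintype.card_bool, Nat.card_coe_set_eq]
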